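/- Let $n\ge 2$, $p\ge 1$, $k\ge 1$, $z\in\{1,\dots,n-1\}$, $\sigma>0$, $q=(q_1,\dots,q_p)\in(0,1]^p$, and let $\mu^{(1)},\mu^{(2)}\in\mathbb{R}^p$ be such that $\theta:=\mu^{(2)}-\mu^{(1)}\neq 0$ satisfies $\|\theta\|_0:=|\{j:\theta_j\ne 0\}|\le k$. Put $\tau:=n^{-1}\min(z,n-z)$, $\|\theta\|_{2,q}:=\bigl(\sum_{j=1}^p\theta_j^2q_j\bigr)^{1/2}$ and $\theta\circ\sqrt q:=(\theta_1\sqrt{q_1},\dots,\theta_p\sqrt{q_p})^\top$. Let $X=(X_{j,t})\in\mathbb{R}^{p\times n}$ be a random matrix whose columns are independent with $X_t\sim N_p(\mu^{(1)},\sigma^2I_p)$ for $t\le z$ and $X_t\sim N_p(\mu^{(2)},\sigma^2I_p)$ for $t>z$. Let $\Omega=(\omega_{j,t})\in\{0,1\}^{p\times n}$ be independent of $X$, with independent entries $\omega_{j,t}\sim\mathrm{Bern}(q_j)$. Let $X_\Omega:=X\circ\Omega$ be the entrywise product. For $j\in\{1,\dots,p\}$ and $t\in\{1,\dots,n-1\}$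 let $L_{j,t}:=\sum_{r=1}^t\omega_{j,r}$, $R_{j,n-t}:=\sum_{r=t+1}^n\omega_{j,r}$, $N_j:=\sum_{r=1}^n\omega_{j,r}$, and define the MissCUSUM matrix $T_\Omega\in\mathbb{R}^{p\times(n-1)}$ by \[ (T_\Omega)_{j,t}:=\sqrt{\frac{L_{j,t}R_{j,n-t}}{N_j}}\Bigl(\frac1{R_{j,n-t}}\sum_{r=t+1}^n (X_\Omega)_{j,r}-\frac1{L_{j,t}}\sum_{r=1}^t (X_\Omega)_{j,r}\Bigr) \] if $L_{j,t}>0$ and $R_{j,n-t}>0$, and $(T_\Omega)_{j,t}:=0$ otherwise. Let $\lambda\ge 2\sigma\sqrt{n\log(pn)}$, and let $(\hat v,\hat w)$ be any maximiser of \[ \langle T_\Omega,\tilde v\tilde w^\top\rangle-\lambda\|\tilde v\|_1 \] over $\tilde v\in\mathbb{R}^p$, $\tilde w\in\mathbb{R}^{n-1}$ with $\|\tilde v\|_2\le 1$, $\|\tilde w\|_2\le 1$. For non-zero $u,u'\in\mathbb{R}^p$ let $\angle(u,u'):=\cos^{-1}\bigl(|\langle u,u'\rangle|/(\|u\|_2\|u'\|_2)\bigr)$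 be the acute angle between them, and put $\angle(0,u'):=\pi/2$. Then, with probability at least $1-\frac{6}{kn}$, \[ \sin\angle(\hat v,\theta\circ\sqrt q)\le\frac{32\lambda\sqrt k}{n\tau\|\theta\|_{2,q}}+\frac{112\|\theta\|_2}{\tau\|\theta\|_{2,q}}\sqrt{\frac{6\log(kn)}{n}} . \] -/

import Mathlib

open MeasureTheory ProbabilityTheory

noncomputable section

namespace MissInspect

/-- The entrywise product `M ∘ Ω` of a data matrix with a `0/1` revelation matrix. Columns are
indexed by `Fin n`, the index `r` standing for the time `r + 1`. -/
def masked {p n : ℕ} (M : Fin p → Fin n → ℝ) (O : Fin p → Fin n → Bool) : Fin p → Fin n → ℝ :=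
  fun j r => M j r * (if O j r then 1 else 0)

/-- `L_{j,t}`: the number of observed entries in row `j` at the first `t` times. -/
def leftCount {p n : ℕ} (O : Fin p → Fin n → Bool) (j : Fin p) (t : ℕ) : ℝ :=
  ∑ r : Fin n with r.val < t, (if O j r then 1 else 0)

/-- `R_{j,t}`: the number of observed entries in row `j` at the last `t` times. -/
def rightCount {p n : ℕ} (O : Fin p → Fin n → Bool) (j : Fin p) (t : ℕ) : ℝ :=
  ∑ r : Fin n with n - t ≤ r.val, (if O j r then 1 else 0)

/-- The entry in row `j` of the MissCUSUM transformation at the time `t ∈ {1, …, n - 1}`. -/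
def missCUSUMEntry {p n : ℕ} (M : Fin p → Fin n → ℝ) (O : Fin p → Fin n → Bool)
    (j : Fin p) (t : ℕ) : ℝ :=
  if 0 < leftCount O j t ∧ 0 < rightCount O j (n - t) then
    √(leftCount O j t * rightCount O j (n - t) / leftCount O j n) *
      (1 / rightCount O j (n - t) * ∑ r : Fin n with t ≤ r.val, masked M O j r
        - 1 / leftCount O j t * ∑ r : Fin n with r.val < t, masked M O j r)
  else 0

/-- The MissCUSUM transformation; the column index `s` stands for the time `s + 1`. -/
def missCUSUM {p n : ℕ} (M : Fin p → Fin n → ℝ) (O : Fin p → Fin n → Bool) :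
    Fin p → Fin (n - 1) → ℝ :=
  fun j s => missCUSUMEntry M O j (s.val + 1)

/-- The penalised objective `⟨T, v wᵀ⟩ - lam ‖v‖₁`. -/
def objective {p m : ℕ} (T : Fin p → Fin m → ℝ) (lam : ℝ)
    (x : EuclideanSpace ℝ (Fin p) × EuclideanSpace ℝ (Fin m)) : ℝ :=
  ∑ j, ∑ s, T j s * (x.1 j * x.2 s) - lam * ∑ j, |x.1 j|

/-- `(v, w)` maximises the penalised objective over the product of the closed unit balls. -/
def IsArgmax {p m : ℕ} (T : Fin p → Fin m → ℝ) (lam : ℝ)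
    (v : EuclideanSpace ℝ (Fin p)) (w : EuclideanSpace ℝ (Fin m)) : Prop :=
  ‖v‖ ≤ 1 ∧ ‖w‖ ≤ 1 ∧ IsMaxOn (objective T lam) {x | ‖x.1‖ ≤ 1 ∧ ‖x.2‖ ≤ 1} (v, w)

/-- The acute angle between two vectors (equal to `π / 2` if one of them vanishes). -/
def acuteAngle {p : ℕ} (u v : EuclideanSpace ℝ (Fin p)) : ℝ :=
  Real.arccos (|inner ℝ u v| / (‖u‖ * ‖v‖))

/-- The weighted norm `‖u‖_{2,q} = (∑ u_j² q_j)^{1/2}`. -/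
def weightedNorm {p : ℕ} (q : Fin p → unitInterval) (u : EuclideanSpace ℝ (Fin p)) : ℝ :=
  √(∑ j, (u j) ^ 2 * (q j : ℝ))

/-- The vector `θ ∘ √q`. -/
def oracleDirection {p : ℕ} (q : Fin p → unitInterval) (θ : EuclideanSpace ℝ (Fin p)) :
    EuclideanSpace ℝ (Fin p) :=
  WithLp.toLp 2 fun j => θ j * √(q j : ℝ)

/-- The mean matrix with columns `μ₁` at the times `1, …, z` and `μ₂` at the times `z+1, …, n`. -/
def changeMean {p : ℕ} (n z : ℕ) (μ₁ μ₂ : EuclideanSpace ℝ (Fin p)) : Fin p → Fin n → ℝ :=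
  fun j r => if r.val < z then μ₁ j else μ₂ j

/-- The joint law of the data and the revelation matrix: the data entries are independent normal
variables with variance `σ²` and means `changeMean n z μ₁ μ₂` (so the columns are independent
with law `N_p(μ_t, σ² I)`), the revelation indicators in row `j` are Bernoulli with
parameter `q j`, all independent, and the two matrices are independent. -/
def modelLaw {p : ℕ} (n z : ℕ) (μ₁ μ₂ : EuclideanSpace ℝ (Fin p)) (σ : ℝ)
    (q : Fin p → unitInterval) :
    Measure ((Fin p → Fin n → ℝ) × (Fin p → Fin n → Bool)) :=
  (Measure.pi fun j => Measure.pi fun r =>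
      gaussianReal (changeMean n z μ₁ μ₂ j r) (σ ^ 2).toNNReal).prod
    (Measure.pi fun j => Measure.pi fun _ : Fin n => bernoulliMeasure true false (q j))

/-- `τ = n⁻¹ min(z, n - z)`. -/
def changeTau (n z : ℕ) : ℝ := min (z : ℝ) ((n : ℝ) - z) / n

end MissInspect

end

/-!
Compare the maximiser `(v, w)` with the pair `(u, g)` of normalised vectors `u ∝ θ ∘ √q` and `g`,
where `g` is the CUSUM profile of a fully observed change. Each row of the MissCUSUM matrix is the
corresponding row of a multiple of `u gᵀ`, plus a noise row, plus a bias row caused by the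
fluctuation of the numbers of observations. Optimality of `(v, w)` bounds the loss of alignment
`1 - ⟨u, v⟩⟨g, w⟩`, and hence the sine of the angle, by the noise and the bias: the penalty absorbs
the noise off the support of `θ`, and Cauchy–Schwarz controls it on the support.

Given the revelation matrix, a noise entry is a contrast with weights of Euclidean norm at most one,
hence sub-Gaussian. The CUSUM of a step depends on the counts only through bounded combinations of
their square roots, and the square root of a binomial count concentrates around the square root of
its mean at a constant scale, whatever the observation probability. This is what makes the bias
proportional to `θ` rather than to `θ / √q`.
-/

namespace MissInspect

section SubGaussian

variable {Ω : Type*} [MeasurableSpace Ω] {P : Measure Ω}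

theorem measureReal_lt_abs_le_of_hasSubgaussianMGF [IsFiniteMeasure P] {X : Ω → ℝ}
    {c : NNReal} (h : HasSubgaussianMGF X c P) {u : ℝ} (hu : 0 ≤ u) :
    P.real {ω | u < |X ω|} ≤ 2 * Real.exp (-u ^ 2 / (2 * c)) := by
  rw [two_mul]
  refine le_trans ?_ (add_le_add (h.measure_ge_le hu) (h.neg.measure_ge_le hu))
  refine (measureReal_mono fun ω hω => ?_).trans (measureReal_union_le _ _)
  exact (lt_abs.1 hω).imp le_of_lt fun h => show u ≤ -X ω from h.le

theorem hasSubgaussianMGF_sub_gaussianReal (μ : ℝ) (v : NNReal) :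
    HasSubgaussianMGF (fun x => x - μ) v (gaussianReal μ v) := by
  rw [← HasSubgaussianMGF.id_map_iff (by fun_prop), gaussianReal_map_sub_const, sub_self]
  exact ⟨integrable_exp_mul_gaussianReal, fun t => by
    rw [mgf_gaussianReal (μ := 0) (v := v) (by simp), zero_mul, zero_add]⟩

theorem hasSubgaussianMGF_dotProduct_sub_gaussian {ι : Type*} [Fintype ι] (μ c : ι → ℝ)
    (v : NNReal) (hc : ∑ i, c i ^ 2 ≤ 1) :
    HasSubgaussianMGF (fun x : ι → ℝ => c ⬝ᵥ (x - μ)) v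
      (Measure.pi fun i => gaussianReal (μ i) v) := by
  have h_indep : iIndepFun (fun i (x : ι → ℝ) => c i * (x i - μ i))
      (Measure.pi fun i => gaussianReal (μ i) v) :=
    iIndepFun_pi (X := fun i (x : ℝ) => c i * (x - μ i)) fun i => by fun_prop
  have h_coord (i : ι) : HasSubgaussianMGF (fun x : ι → ℝ => x i - μ i) v
      (Measure.pi fun i => gaussianReal (μ i) v) := by
    refine HasSubgaussianMGF.of_map (measurable_pi_apply i).aemeasurable
      (X := fun x : ℝ => x - μ i) ?_
    rw [(measurePreserving_eval (fun i => gaussianReal (μ i) v) i).map_eq]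
    exact hasSubgaussianMGF_sub_gaussianReal (μ i) v
  have h_sum := HasSubgaussianMGF.sum_of_iIndepFun h_indep (s := Finset.univ)
    (c := fun i => NNReal.mk (c i ^ 2) (sq_nonneg _) * v) fun i _ => (h_coord i).const_mul (c i)
  refine ⟨h_sum.integrable_exp_mul, fun t => (h_sum.mgf_le t).trans ?_⟩
  have h_proxy : ∑ i, c i ^ 2 * (v : ℝ) ≤ v := by
    rw [← Finset.sum_mul]
    exact mul_le_of_le_one_left v.2 hc
  gcongr
  rw [← NNReal.coe_le_coe]
  simpa only [NNReal.coe_sum, NNReal.coe_mul, NNReal.coe_mk] using h_proxy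

end SubGaussian

section SubPoisson

/-- `X` is sub-Poisson with mean parameter `m`: its moment generating function is at most that of
the Poisson law of mean `m`. -/
structure HasSubPoissonMGF {Ω : Type*} [MeasurableSpace Ω] (X : Ω → ℝ) (m : ℝ)
    (P : Measure Ω) : Prop where
  integrable_exp_mul (t : ℝ) : Integrable (fun ω => Real.exp (t * X ω)) P
  mgf_le (t : ℝ) : mgf X P t ≤ Real.exp (m * (Real.exp t - 1))

-- The left side is a Hellinger distance and the right side the Kullback–Leibler divergence between
-- the Poisson laws of means `a` and `m`.
theorem sq_sqrt_sub_sqrt_le_mul_log_div {a m : ℝ} (ha : 0 < a) (hm : 0 < m) :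
    (√a - √m) ^ 2 ≤ a * Real.log (a / m) - a + m := by
  have h_log : Real.log (a / m) = -2 * Real.log (√m / √a) := by
    rw [← Real.sqrt_div hm.le, Real.log_sqrt (by positivity), ← inv_div m a, Real.log_inv]
    ring
  have h_le := Real.log_le_sub_one_of_pos (div_pos (Real.sqrt_pos.2 hm) (Real.sqrt_pos.2 ha))
  have h_geom : a * (√m / √a) = √a * √m := by
    rw [mul_div_left_comm, Real.div_sqrt, mul_comm]
  rw [h_log]
  nlinarith [Real.sq_sqrt ha.le, Real.sq_sqrt hm.le, mul_le_mul_of_nonneg_left h_le ha.le]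

namespace HasSubPoissonMGF

variable {Ω : Type*} [MeasurableSpace Ω] {X : Ω → ℝ} {m : ℝ} {P : Measure Ω}

theorem exp_mul_mgf_log_div_le (h : HasSubPoissonMGF X m P) (hm : 0 < m) {b : ℝ} (hb : 0 < b) :
    Real.exp (-Real.log (b ^ 2 / m) * b ^ 2) * mgf X P (Real.log (b ^ 2 / m)) ≤
      Real.exp (-(b - √m) ^ 2) := by
  have h_mgf := h.mgf_le (Real.log (b ^ 2 / m))
  rw [Real.exp_log (by positivity)] at h_mgf
  refine (mul_le_mul_of_nonneg_left h_mgf (Real.exp_pos _).le).trans ?_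
  rw [← Real.exp_add, Real.exp_le_exp]
  have h_rate := sq_sqrt_sub_sqrt_le_mul_log_div (pow_pos hb 2) hm
  have h_mean : m * (b ^ 2 / m - 1) = b ^ 2 - m := by field_simp
  rw [Real.sqrt_sq hb.le] at h_rate
  rw [h_mean]
  linarith

theorem measureReal_sqrt_add_le_sqrt_le [IsFiniteMeasure P] (h : HasSubPoissonMGF X m P)
    (hm : 0 < m) {x : ℝ} (hx : 0 ≤ x) :
    P.real {ω | √m + x ≤ √(X ω)} ≤ Real.exp (-x ^ 2) := by
  have hb : 0 < √m + x := add_pos_of_pos_of_nonneg (Real.sqrt_pos.2 hm) hx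
  simp only [Real.le_sqrt' hb]
  refine (measure_ge_le_exp_mul_mgf _ (Real.log_nonneg ?_) (h.integrable_exp_mul _)).trans
    ((h.exp_mul_mgf_log_div_le hm hb).trans_eq ?_)
  · rw [one_le_div hm]
    nlinarith [Real.sq_sqrt hm.le, Real.sqrt_nonneg m]
  · rw [add_sub_cancel_left]

theorem measureReal_sqrt_lt_sqrt_sub_le [IsFiniteMeasure P] (h : HasSubPoissonMGF X m P)
    (hm : 0 < m) {x : ℝ} (hx : 0 ≤ x) :
    P.real {ω | √(X ω) < √m - x} ≤ Real.exp (-x ^ 2) := by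
  rcases le_or_gt (√m) x with hmx | hxm
  · have h_empty : {ω | √(X ω) < √m - x} = ∅ :=
      Set.eq_empty_of_forall_notMem fun ω hω =>
        absurd (lt_of_lt_of_le hω (sub_nonpos.2 hmx)) (Real.sqrt_nonneg _).not_gt
    rw [h_empty, measureReal_empty]
    exact (Real.exp_pos _).le
  have hb : 0 < √m - x := sub_pos.2 hxm
  calc P.real {ω | √(X ω) < √m - x}
      ≤ P.real {ω | X ω ≤ (√m - x) ^ 2} :=
        measureReal_mono fun ω hω => (Real.sqrt_le_left hb.le).1 (le_of_lt hω)
    _ ≤ Real.exp (-Real.log ((√m - x) ^ 2 / m) * (√m - x) ^ 2) *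
          mgf X P (Real.log ((√m - x) ^ 2 / m)) := by
        refine measure_le_le_exp_mul_mgf _ (Real.log_nonpos (by positivity) ?_)
          (h.integrable_exp_mul _)
        rw [div_le_one hm]
        nlinarith [Real.sq_sqrt hm.le, Real.sqrt_nonneg m]
    _ ≤ Real.exp (-x ^ 2) := by
        simpa only [sub_sub_cancel_left, neg_sq] using h.exp_mul_mgf_log_div_le hm hb

theorem measureReal_lt_abs_sqrt_sub_sqrt_le [IsFiniteMeasure P] (h : HasSubPoissonMGF X m P)
    (hm : 0 < m) {x : ℝ} (hx : 0 ≤ x) :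
    P.real {ω | x < |√(X ω) - √m|} ≤ 2 * Real.exp (-x ^ 2) := by
  rw [two_mul]
  refine le_trans ?_ (add_le_add (h.measureReal_sqrt_add_le_sqrt_le hm hx)
    (h.measureReal_sqrt_lt_sqrt_sub_le hm hx))
  refine (measureReal_mono fun ω hω => ?_).trans (measureReal_union_le _ _)
  rw [Set.mem_ofPred_eq, lt_abs] at hω
  simp only [Set.mem_union, Set.mem_ofPred_eq]
  grind

end HasSubPoissonMGF

theorem mgf_bernoulliMeasure_le (q : unitInterval) (t : ℝ) :
    mgf (fun b : Bool => if b then (1 : ℝ) else 0) (bernoulliMeasure true false q) t ≤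
      Real.exp (q * (Real.exp t - 1)) := by
  have h_mgf : mgf (fun b : Bool => if b then (1 : ℝ) else 0) (bernoulliMeasure true false q) t =
      q * (Real.exp t - 1) + 1 := by
    rw [mgf, integral_bernoulliMeasure]
    simp only [smul_eq_mul, if_true, Bool.false_eq_true, if_false, mul_one, mul_zero,
      Real.exp_zero]
    ring
  exact h_mgf.trans_le (Real.add_one_le_exp _)

variable {ι : Type*}

/-- The number of successes among the indices in `A`; for row `j` of the revelation matrix it is
the number of observed entries at the times in `A`. -/
noncomputable def successCount (A : Finset ι) (ω : ι → Bool) : ℝ :=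
  ∑ r ∈ A, if ω r then 1 else 0

theorem successCount_nonneg (A : Finset ι) (ω : ι → Bool) : 0 ≤ successCount A ω :=
  Finset.sum_nonneg fun r _ => by split_ifs <;> norm_num

theorem successCount_mono (ω : ι → Bool) : Monotone fun A => successCount A ω := fun _ _ hAB =>
  Finset.sum_le_sum_of_subset_of_nonneg hAB fun _ _ _ => by split_ifs <;> norm_num

theorem hasSubPoissonMGF_successCount [Fintype ι] (q : unitInterval) (A : Finset ι) :
    HasSubPoissonMGF (successCount A) (A.card * q)
      (Measure.pi fun _ : ι => bernoulliMeasure true false q) := by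
  refine ⟨fun t => Integrable.of_finite, fun t => ?_⟩
  have h_indep : iIndepFun (fun r (ω : ι → Bool) => if ω r then (1 : ℝ) else 0)
      (Measure.pi fun _ : ι => bernoulliMeasure true false q) :=
    iIndepFun_pi (X := fun _ (b : Bool) => if b then (1 : ℝ) else 0)
      fun _ => (measurable_of_countable _).aemeasurable
  have h_coord (r : ι) : mgf (fun ω : ι → Bool => if ω r then (1 : ℝ) else 0)
      (Measure.pi fun _ : ι => bernoulliMeasure true false q) t ≤
        Real.exp (q * (Real.exp t - 1)) := by
    have h_map := mgf_map (X := fun b : Bool => if b then (1 : ℝ) else 0)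
      (Y := fun ω : ι → Bool => ω r) (t := t)
      (μ := Measure.pi fun _ : ι => bernoulliMeasure true false q)
      (measurable_pi_apply r).aemeasurable
      (measurable_of_countable _).aestronglyMeasurable
    rw [(measurePreserving_eval (fun _ : ι => bernoulliMeasure true false q) r).map_eq] at h_map
    exact h_map.symm.trans_le (mgf_bernoulliMeasure_le q t)
  have h_sum : successCount A = ∑ r ∈ A, fun ω : ι → Bool => if ω r then (1 : ℝ) else 0 := by
    ext ω
    simp only [successCount, Finset.sum_apply]
  rw [h_sum, h_indep.mgf_sum fun _ => measurable_of_countable _]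
  refine (Finset.prod_le_prod (fun _ _ => mgf_nonneg) fun r _ => h_coord r).trans_eq ?_
  rw [Finset.prod_const, ← Real.exp_nat_mul, mul_assoc]

end SubPoisson

theorem sum_le_sqrt_mul_sqrt_of_card_le {ι : Type*} {s : Finset ι} {y : ι → ℝ}
    {k x : ℝ} (hs : s.card ≤ k) (hy : ∑ j ∈ s, y j ^ 2 ≤ x) : ∑ j ∈ s, y j ≤ √k * √x :=
  calc ∑ j ∈ s, y j ≤ √(∑ j ∈ s, 1 ^ 2) * √(∑ j ∈ s, y j ^ 2) := by
        simpa only [one_mul] using Real.sum_mul_le_sqrt_mul_sqrt s (fun _ => 1) y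
    _ ≤ √k * √x := by
        gcongr
        simpa only [one_pow, Finset.sum_const, nsmul_eq_mul, mul_one] using hs

section Perturbation

variable {ι F : Type*} [Fintype ι] [NormedAddCommGroup F] [InnerProductSpace ℝ F]
  {v u : EuclideanSpace ℝ ι} {w g : F}

theorem sum_inner_le_mul_sqrt {B Y : ι → F} {b x : ℝ} (hb : 0 ≤ b)
    (hB : ∑ j, ‖B j‖ ^ 2 ≤ b ^ 2) (hY : ∑ j, ‖Y j‖ ^ 2 ≤ x) :
    ∑ j, inner ℝ (B j) (Y j) ≤ b * √x :=
  calc ∑ j, inner ℝ (B j) (Y j) ≤ ∑ j, ‖B j‖ * ‖Y j‖ :=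
        Finset.sum_le_sum fun _ _ => real_inner_le_norm _ _
    _ ≤ √(∑ j, ‖B j‖ ^ 2) * √(∑ j, ‖Y j‖ ^ 2) := Real.sum_mul_le_sqrt_mul_sqrt _ _ _
    _ ≤ b * √x := by
        gcongr
        exact Real.sqrt_le_iff.2 ⟨hb, hB⟩

theorem abs_sub_abs_le_norm_smul_sub_smul (hw : ‖w‖ ≤ 1) (hg : ‖g‖ = 1) (a b : ℝ) :
    |a| - |b| ≤ ‖b • w - a • g‖ :=
  calc |a| - |b| ≤ ‖a • g‖ - ‖b • w‖ := by
        rw [norm_smul, norm_smul, hg, mul_one, Real.norm_eq_abs, Real.norm_eq_abs]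
        exact sub_le_sub_left (mul_le_of_le_one_right (abs_nonneg b) hw) _
    _ ≤ ‖b • w - a • g‖ := norm_sub_rev (a • g) (b • w) ▸ norm_sub_norm_le _ _

theorem sum_norm_smul_sub_smul_sq_le (hv : ‖v‖ ≤ 1) (hw : ‖w‖ ≤ 1) (hu : ‖u‖ = 1)
    (hg : ‖g‖ = 1) :
    ∑ j, ‖v j • w - u j • g‖ ^ 2 ≤ 2 * (1 - inner ℝ u v * inner ℝ g w) := by
  have h_row (j : ι) : ‖v j • w - u j • g‖ ^ 2 =
      v j ^ 2 * ‖w‖ ^ 2 - 2 * (v j * u j * inner ℝ g w) + u j ^ 2 := by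
    rw [norm_sub_sq_real, norm_smul, norm_smul, inner_smul_left, inner_smul_right,
      real_inner_comm, hg, mul_pow, mul_one, Real.norm_eq_abs, Real.norm_eq_abs, sq_abs, sq_abs,
      conj_trivial]
    ring
  have h_expand : ∑ j, ‖v j • w - u j • g‖ ^ 2 =
      ‖v‖ ^ 2 * ‖w‖ ^ 2 - 2 * (inner ℝ u v * inner ℝ g w) + ‖u‖ ^ 2 := by
    simp only [h_row, Finset.sum_add_distrib, Finset.sum_sub_distrib, ← Finset.sum_mul,
      ← Finset.mul_sum, EuclideanSpace.real_norm_sq_eq, PiLp.inner_apply, RCLike.inner_apply,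
      conj_trivial]
  have h_le : ‖v‖ ^ 2 * ‖w‖ ^ 2 ≤ 1 :=
    mul_le_one₀ (pow_le_one₀ (norm_nonneg v) hv) (by positivity) (pow_le_one₀ (norm_nonneg w) hw)
  rw [h_expand, hu]
  linarith

theorem sum_inner_smul_smul_sub_smul (hu : ‖u‖ = 1) (hg : ‖g‖ = 1) :
    ∑ j, inner ℝ (u j • g) (v j • w - u j • g) = inner ℝ u v * inner ℝ g w - 1 := by
  have h_row (j : ι) : inner ℝ (u j • g) (v j • w - u j • g) =
      v j * u j * inner ℝ g w - u j ^ 2 := by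
    rw [inner_sub_right, inner_smul_left, inner_smul_left, inner_smul_right, inner_smul_right,
      real_inner_self_eq_norm_sq, hg, conj_trivial]
    ring
  have h_norm : ∑ j, u j ^ 2 = 1 := by rw [← EuclideanSpace.real_norm_sq_eq, hu, one_pow]
  simp only [h_row, Finset.sum_sub_distrib, ← Finset.sum_mul, h_norm, PiLp.inner_apply,
    RCLike.inner_apply, conj_trivial]

-- Off the support of `u` the row `v j • w - u j • g` has norm at most `|v j|`, so the penalty
-- absorbs the part `lam` of the noise there.
theorem sum_inner_add_mul_sum_abs_sub_abs_le {E : ι → F} {lam δ x : ℝ} {k : ℕ} (hlam : 0 ≤ lam)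
    (hδ : 0 ≤ δ) (hw : ‖w‖ ≤ 1) (hg : ‖g‖ = 1) (hE : ∀ j, ‖E j‖ ≤ lam + δ)
    (hk : (Finset.univ.filter fun j => u j ≠ 0).card ≤ k)
    (hx : ∑ j, ‖v j • w - u j • g‖ ^ 2 ≤ x) :
    ∑ j, inner ℝ (E j) (v j • w - u j • g) + lam * ∑ j, (|u j| - |v j|) ≤
      (2 * lam * √k + δ * √(Fintype.card ι)) * √x := by
  set y : ι → ℝ := fun j => ‖v j • w - u j • g‖
  have h_row (j : ι) : inner ℝ (E j) (v j • w - u j • g) + lam * (|u j| - |v j|) ≤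
      (if u j ≠ 0 then 2 * lam * y j else 0) + δ * y j := by
    have h_inner : inner ℝ (E j) (v j • w - u j • g) ≤ (lam + δ) * y j :=
      (real_inner_le_norm _ _).trans (by gcongr; exact hE j)
    split_ifs with huj
    · have := mul_le_mul_of_nonneg_left (abs_sub_abs_le_norm_smul_sub_smul hw hg (u j) (v j)) hlam
      linarith
    · have h_off : y j ≤ |v j| := by
        simp only [y, not_not.1 huj, zero_smul, sub_zero, norm_smul, Real.norm_eq_abs]
        exact mul_le_of_le_one_right (abs_nonneg _) hw
      have := mul_le_mul_of_nonneg_left h_off hlam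
      rw [not_not.1 huj, abs_zero]
      rw [not_not.1 huj] at h_inner
      linarith
  have h_supp : ∑ j with u j ≠ 0, y j ≤ √k * √x :=
    sum_le_sqrt_mul_sqrt_of_card_le (by exact_mod_cast hk)
      ((Finset.sum_le_univ_sum_of_nonneg fun j => sq_nonneg (y j)).trans hx)
  have h_all : ∑ j, y j ≤ √(Fintype.card ι) * √x :=
    sum_le_sqrt_mul_sqrt_of_card_le (by rw [Finset.card_univ]) hx
  calc ∑ j, inner ℝ (E j) (v j • w - u j • g) + lam * ∑ j, (|u j| - |v j|)
      = ∑ j, (inner ℝ (E j) (v j • w - u j • g) + lam * (|u j| - |v j|)) := by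
        rw [Finset.mul_sum, Finset.sum_add_distrib]
    _ ≤ ∑ j, ((if u j ≠ 0 then 2 * lam * y j else 0) + δ * y j) :=
        Finset.sum_le_sum fun j _ => h_row j
    _ = 2 * lam * (∑ j with u j ≠ 0, y j) + δ * ∑ j, y j := by
        rw [Finset.sum_add_distrib, Finset.sum_filter, Finset.mul_sum, Finset.mul_sum]
        simp only [mul_ite, mul_zero]
    _ ≤ 2 * lam * (√k * √x) + δ * (√(Fintype.card ι) * √x) := by gcongr
    _ = (2 * lam * √k + δ * √(Fintype.card ι)) * √x := by ring

end Perturbation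

section Angle

variable {p : ℕ}

theorem sin_acuteAngle_le_sqrt {v u : EuclideanSpace ℝ (Fin p)} (hv : ‖v‖ ≤ 1) (hu : ‖u‖ = 1)
    {c : ℝ} (hc : |c| ≤ 1) :
    Real.sin (acuteAngle v u) ≤ √(2 * (1 - inner ℝ u v * c)) := by
  set a := |inner ℝ v u| / (‖v‖ * ‖u‖) with ha
  have h_cos : inner ℝ u v * c ≤ a := by
    rw [ha, hu, mul_one, real_inner_comm]
    rcases eq_or_ne v 0 with rfl | hv0
    · simp
    calc inner ℝ v u * c ≤ |inner ℝ v u| * |c| := (le_abs_self _).trans (abs_mul _ _).le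
      _ ≤ |inner ℝ v u| := mul_le_of_le_one_right (abs_nonneg _) hc
      _ ≤ |inner ℝ v u| / ‖v‖ :=
        le_div_self (abs_nonneg _) (norm_pos_iff.2 hv0) hv
  rw [acuteAngle, Real.sin_arccos]
  apply Real.sqrt_le_sqrt
  linarith [sq_nonneg (1 - a)]

theorem acuteAngle_smul_right (v u : EuclideanSpace ℝ (Fin p)) {c : ℝ} (hc : 0 < c) :
    acuteAngle v (c • u) = acuteAngle v u := by
  rw [acuteAngle, acuteAngle, inner_smul_right, norm_smul, abs_mul, Real.norm_of_nonneg hc.le,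
    abs_of_pos hc, mul_left_comm, mul_div_mul_left _ _ hc.ne']

end Angle

section Argmax

variable {p m k : ℕ} {T : Fin p → Fin m → ℝ} {E B : Fin p → EuclideanSpace ℝ (Fin m)}
  {v : EuclideanSpace ℝ (Fin p)} {w g : EuclideanSpace ℝ (Fin m)} {lam δ b : ℝ}

theorem objective_eq_sum_inner (T : Fin p → Fin m → ℝ) (lam : ℝ) (v : EuclideanSpace ℝ (Fin p))
    (w : EuclideanSpace ℝ (Fin m)) :
    objective T lam (v, w) =
      ∑ j, inner ℝ (WithLp.toLp 2 (T j)) (v j • w) - lam * ∑ j, |v j| := by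
  simp only [objective, PiLp.inner_apply, RCLike.inner_apply, conj_trivial, PiLp.smul_apply,
    smul_eq_mul, mul_comm]

theorem IsArgmax.mul_one_sub_inner_mul_inner_le {u : EuclideanSpace ℝ (Fin p)} {D : ℝ}
    (h : IsArgmax T lam v w) (hu : ‖u‖ = 1) (hg : ‖g‖ = 1)
    (hT : ∀ j, WithLp.toLp 2 (T j) = D • u j • g + E j + B j) :
    D * (1 - inner ℝ u v * inner ℝ g w) ≤
      (∑ j, inner ℝ (E j) (v j • w - u j • g) + lam * ∑ j, (|u j| - |v j|)) +
        ∑ j, inner ℝ (B j) (v j • w - u j • g) := by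
  have h_opt : objective T lam (u, g) ≤ objective T lam (v, w) := h.2.2 ⟨hu.le, hg.le⟩
  have h_gain : ∑ j, inner ℝ (WithLp.toLp 2 (T j)) (v j • w - u j • g) =
      D * (inner ℝ u v * inner ℝ g w - 1) + ∑ j, inner ℝ (E j) (v j • w - u j • g) +
        ∑ j, inner ℝ (B j) (v j • w - u j • g) := by
    simp only [hT, inner_add_left, Finset.sum_add_distrib, real_inner_smul_left (r := D),
      ← Finset.mul_sum, sum_inner_smul_smul_sub_smul hu hg]
  rw [objective_eq_sum_inner, objective_eq_sum_inner] at h_opt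
  simp only [inner_sub_right, Finset.sum_sub_distrib] at h_gain ⊢
  linarith

theorem IsArgmax.sin_acuteAngle_le_of_norm_eq_one {u : EuclideanSpace ℝ (Fin p)} {D : ℝ}
    (h : IsArgmax T lam v w) (hD : 0 < D) (hlam : 0 ≤ lam) (hδ : 0 ≤ δ) (hb : 0 ≤ b)
    (hu : ‖u‖ = 1) (hg : ‖g‖ = 1) (hk : (Finset.univ.filter fun j => u j ≠ 0).card ≤ k)
    (hT : ∀ j, WithLp.toLp 2 (T j) = D • u j • g + E j + B j)
    (hE : ∀ j, ‖E j‖ ≤ lam + δ) (hB : ∑ j, ‖B j‖ ^ 2 ≤ b ^ 2) :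
    Real.sin (acuteAngle v u) ≤ 2 * (2 * lam * √k + δ * √p + b) / D := by
  set x := 1 - inner ℝ u v * inner ℝ g w
  have h_sq := sum_norm_smul_sub_smul_sq_le h.1 h.2.1 hu hg
  have hx : 0 ≤ 2 * x := (Finset.sum_nonneg fun j _ => sq_nonneg _).trans h_sq
  have h_basic : D * x ≤ (2 * lam * √k + δ * √p + b) * √(2 * x) := by
    have h_noise := sum_inner_add_mul_sum_abs_sub_abs_le hlam hδ h.2.1 hg hE hk h_sq
    rw [Fintype.card_fin] at h_noise
    linarith [h.mul_one_sub_inner_mul_inner_le hu hg hT, sum_inner_le_mul_sqrt hb hB h_sq]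
  have h_cos : |inner ℝ g w| ≤ 1 :=
    (abs_real_inner_le_norm g w).trans (by rw [hg, one_mul]; exact h.2.1)
  refine (sin_acuteAngle_le_sqrt h.1 hu h_cos).trans ?_
  rw [le_div_iff₀ hD]
  rcases (Real.sqrt_nonneg (2 * x)).eq_or_lt with h_zero | h_pos
  · rw [← h_zero, zero_mul]
    positivity
  · refine le_of_mul_le_mul_right ?_ h_pos
    linear_combination 2 * h_basic + D * Real.mul_self_sqrt hx

theorem IsArgmax.sin_acuteAngle_le {a : EuclideanSpace ℝ (Fin p)}
    (h : IsArgmax T lam v w) (hlam : 0 ≤ lam) (hδ : 0 ≤ δ) (hb : 0 ≤ b)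
    (ha : a ≠ 0) (hg : g ≠ 0) (hk : (Finset.univ.filter fun j => a j ≠ 0).card ≤ k)
    (hT : ∀ j, WithLp.toLp 2 (T j) = a j • g + E j + B j)
    (hE : ∀ j, ‖E j‖ ≤ lam + δ) (hB : ∑ j, ‖B j‖ ^ 2 ≤ b ^ 2) :
    Real.sin (acuteAngle v a) ≤ 2 * (2 * lam * √k + δ * √p + b) / (‖a‖ * ‖g‖) := by
  have ha_pos := norm_pos_iff.2 ha
  have hg_pos := norm_pos_iff.2 hg
  rw [← acuteAngle_smul_right v a (inv_pos.2 ha_pos)]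
  refine h.sin_acuteAngle_le_of_norm_eq_one (mul_pos ha_pos hg_pos) hlam hδ hb
    (norm_smul_inv_norm (𝕜 := ℝ) ha) (norm_smul_inv_norm (𝕜 := ℝ) hg) ?_ (fun j => ?_) hE hB
  · simpa [ha] using hk
  · rw [hT, PiLp.smul_apply, smul_smul, smul_smul, smul_eq_mul]
    congr 3
    simp only [RCLike.ofReal_real_eq_id, id_eq]
    field_simp

end Argmax

section Contrast

variable {ι : Type*} [Fintype ι] [DecidableEq ι] (A B : Finset ι) (ω : ι → Bool)

/-- The weights of the standardised contrast between the mean of the observed entries outside `A`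
and the mean of those in `A`, where `ω` marks the observed entries. They vanish if one of the two
groups is not observed at all. -/
noncomputable def contrastWeight (r : ι) : ℝ :=
  √(successCount A ω * successCount Aᶜ ω / successCount Finset.univ ω) *
    ((if r ∈ A then -(successCount A ω)⁻¹ else (successCount Aᶜ ω)⁻¹) * if ω r then 1 else 0)

/-- The contrast of `Aᶜ` against `A` evaluated at the indicator of a set `B ⊆ Aᶜ`, as a function of
the numbers `c C` of observed entries in the index sets `C`. -/
noncomputable def stepContrast (c : Finset ι → ℝ) (A B : Finset ι) : ℝ :=
  √(c A) / √(c Finset.univ) * (√(c B) / √(c Aᶜ)) * √(c B)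

theorem sum_ite_mem_mul (a b : ℝ) (f : ι → ℝ) :
    ∑ r, (if r ∈ A then a else b) * f r = a * ∑ r ∈ A, f r + b * ∑ r ∈ Aᶜ, f r := by
  rw [← Finset.sum_add_sum_compl A, Finset.mul_sum, Finset.mul_sum]
  refine congrArg₂ _ (Finset.sum_congr rfl fun r hr => ?_) (Finset.sum_congr rfl fun r hr => ?_)
  · rw [if_pos hr]
  · rw [if_neg (Finset.mem_compl.1 hr)]

theorem successCount_add_compl :
    successCount A ω + successCount Aᶜ ω = successCount Finset.univ ω :=
  Finset.sum_add_sum_compl A _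

theorem contrastWeight_compl (r : ι) : contrastWeight Aᶜ ω r = -contrastWeight A ω r := by
  rw [contrastWeight, contrastWeight, compl_compl, mul_comm (successCount Aᶜ ω)]
  by_cases hr : r ∈ A <;> cases ω r <;> simp [hr]

theorem contrastWeight_dotProduct (x : ι → ℝ) :
    contrastWeight A ω ⬝ᵥ x =
      √(successCount A ω * successCount Aᶜ ω / successCount Finset.univ ω) *
        ((successCount Aᶜ ω)⁻¹ * ∑ r ∈ Aᶜ, x r * (if ω r then 1 else 0) -
          (successCount A ω)⁻¹ * ∑ r ∈ A, x r * if ω r then 1 else 0) := by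
  simp only [dotProduct, contrastWeight, mul_assoc, ← Finset.mul_sum, sum_ite_mem_mul]
  simp only [mul_comm (x _)]
  ring

theorem sum_contrastWeight_sq_le_one : ∑ r, contrastWeight A ω r ^ 2 ≤ 1 := by
  have hA := successCount_nonneg A ω
  have hAc := successCount_nonneg Aᶜ ω
  have h_sq (r : ι) : contrastWeight A ω r ^ 2 =
      successCount A ω * successCount Aᶜ ω / successCount Finset.univ ω *
        ((if r ∈ A then (successCount A ω)⁻¹ ^ 2 else (successCount Aᶜ ω)⁻¹ ^ 2) *
          if ω r then 1 else 0) := by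
    rw [contrastWeight, mul_pow, Real.sq_sqrt (by rw [← successCount_add_compl A]; positivity)]
    split_ifs <;> ring
  simp only [h_sq, ← Finset.mul_sum, sum_ite_mem_mul]
  rw [← successCount, ← successCount, ← successCount_add_compl A]
  rcases hA.eq_or_lt with h | hA
  · simp [← h]
  rcases hAc.eq_or_lt with h | hAc
  · simp [← h]
  apply le_of_eq
  field_simp
  ring

variable {A B} in
theorem sum_contrastWeight_of_subset_compl (hB : B ⊆ Aᶜ) :
    ∑ r ∈ B, contrastWeight A ω r = stepContrast (successCount · ω) A B := by
  have h_weight : ∀ r ∈ B, contrastWeight A ω r =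
      √(successCount A ω * successCount Aᶜ ω / successCount Finset.univ ω) *
        ((successCount Aᶜ ω)⁻¹ * if ω r then 1 else 0) := fun r hr => by
    rw [contrastWeight, if_neg (Finset.mem_compl.1 (hB hr))]
  rw [Finset.sum_congr rfl h_weight, ← Finset.mul_sum, ← Finset.mul_sum, ← successCount,
    stepContrast, Real.sqrt_div (mul_nonneg (successCount_nonneg _ _) (successCount_nonneg _ _)),
    Real.sqrt_mul (successCount_nonneg _ _)]
  have h_inv : √(successCount Aᶜ ω) * (successCount Aᶜ ω)⁻¹ = (√(successCount Aᶜ ω))⁻¹ := by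
    rw [← div_eq_mul_inv, Real.sqrt_div_self]
  have h_sq := Real.mul_self_sqrt (successCount_nonneg B ω)
  linear_combination (√(successCount A ω) / √(successCount Finset.univ ω)) *
    (successCount B ω * h_inv - (√(successCount Aᶜ ω))⁻¹ * h_sq)

theorem stepContrast_compl_self (c : Finset ι → ℝ) :
    stepContrast c A Aᶜ = √(c A) * √(c Aᶜ) / √(c Finset.univ) := by
  rw [stepContrast, mul_assoc, div_self_mul_self]
  ring

theorem sum_contrastWeight : ∑ r, contrastWeight A ω r = 0 := by
  have h_compl : ∑ r ∈ A, contrastWeight A ω r = -stepContrast (successCount · ω) Aᶜ Aᶜᶜ := by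
    rw [← sum_contrastWeight_of_subset_compl ω (subset_refl Aᶜᶜ), compl_compl]
    simp only [contrastWeight_compl, Finset.sum_neg_distrib, neg_neg]
  rw [← Finset.sum_add_sum_compl A, h_compl,
    sum_contrastWeight_of_subset_compl ω (subset_refl Aᶜ), stepContrast_compl_self,
    stepContrast_compl_self, compl_compl]
  ring

end Contrast

section Stability

theorem mul_abs_div_sub_div_le {m r m' r' x : ℝ} (hm : 0 ≤ m) (hmr : m ≤ r)
    (hm' : 0 ≤ m') (hr' : 0 < r') (hmx : |m - m'| ≤ x) (hrx : |r - r'| ≤ x) :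
    r' * |m / r - m' / r'| ≤ 2 * x := by
  have hx : 0 ≤ x := (abs_nonneg _).trans hmx
  rcases (hm.trans hmr).eq_or_lt with rfl | hr
  · rw [le_antisymm hmr hm, zero_sub, abs_neg, abs_of_nonneg hm'] at hmx
    rw [div_zero, zero_sub, abs_neg, abs_of_nonneg (by positivity), mul_div_cancel₀ _ hr'.ne']
    linarith
  calc r' * |m / r - m' / r'| = |m / r * (r' - r) + (m - m')| := by
        nth_rewrite 1 [← abs_of_pos hr']
        rw [← abs_mul]
        congr 1
        field_simp
        ring
    _ ≤ m / r * |r' - r| + |m - m'| := by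
        refine (abs_add_le _ _).trans_eq ?_
        rw [abs_mul, abs_of_nonneg (div_nonneg hm hr.le)]
    _ ≤ 1 * x + x := by
        rw [abs_sub_comm r' r]
        gcongr
        exact (div_le_one hr).2 hmr
    _ = 2 * x := by ring

theorem abs_div_mul_div_mul_sub_le {l N m r l' N' m' r' x : ℝ} (hl : 0 ≤ l) (hm : 0 ≤ m)
    (hlN : l ≤ N) (hmr : m ≤ r) (hl' : 0 ≤ l') (hm' : 0 ≤ m') (hr' : 0 < r') (hmr' : m' ≤ r')
    (hrN' : r' ≤ N') (hlx : |l - l'| ≤ x) (hNx : |N - N'| ≤ x) (hmx : |m - m'| ≤ x)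
    (hrx : |r - r'| ≤ x) :
    |l / N * (m / r) * m - l' / N' * (m' / r') * m'| ≤ 5 * x := by
  have h_outer : N' * |l / N - l' / N'| ≤ 2 * x :=
    mul_abs_div_sub_div_le hl hlN hl' (hr'.trans_le hrN') hlx hNx
  have h_inner : r' * |m / r - m' / r'| ≤ 2 * x := mul_abs_div_sub_div_le hm hmr hm' hr' hmx hrx
  have hlN₁ : l / N ≤ 1 := div_le_one_of_le₀ hlN (hl.trans hlN)
  have hmr₁ : m / r ≤ 1 := div_le_one_of_le₀ hmr (hm.trans hmr)
  have hmr₁' : m' / r' ≤ 1 := div_le_one_of_le₀ hmr' hr'.le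
  have hlN₀ : 0 ≤ l / N := div_nonneg hl (hl.trans hlN)
  have hmr₀ : 0 ≤ m / r := div_nonneg hm (hm.trans hmr)
  have hmr₀' : 0 ≤ m' / r' := div_nonneg hm' hr'.le
  calc |l / N * (m / r) * m - l' / N' * (m' / r') * m'|
      = |l / N * (m / r) * (m - m') + l / N * (m' * (m / r - m' / r')) +
          m' / r' * (m' * (l / N - l' / N'))| := by ring_nf
    _ ≤ l / N * (m / r) * |m - m'| + l / N * (m' * |m / r - m' / r'|) +
          m' / r' * (m' * |l / N - l' / N'|) := by
        refine (abs_add_three _ _ _).trans_eq ?_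
        simp only [abs_mul, abs_of_nonneg hlN₀, abs_of_nonneg hmr₀, abs_of_nonneg hmr₀',
          abs_of_nonneg hm']
    _ ≤ 1 * 1 * x + 1 * (r' * |m / r - m' / r'|) + 1 * (N' * |l / N - l' / N'|) := by
        gcongr
        exact hmr'.trans hrN'
    _ ≤ 5 * x := by linarith

variable {ι : Type*} [Fintype ι] [DecidableEq ι] {c c' : Finset ι → ℝ} {A B : Finset ι}

theorem abs_stepContrast_sub_le {x : ℝ} (hc : Monotone c) (hc' : Monotone c') (hB : B ⊆ Aᶜ)
    (hAc : 0 < c' Aᶜ) (hx : ∀ C ∈ ({A, Finset.univ, B, Aᶜ} : Set (Finset ι)),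
      |√(c C) - √(c' C)| ≤ x) :
    |stepContrast c A B - stepContrast c' A B| ≤ 5 * x :=
  abs_div_mul_div_mul_sub_le (Real.sqrt_nonneg _) (Real.sqrt_nonneg _)
    (Real.sqrt_le_sqrt (hc (Finset.subset_univ A))) (Real.sqrt_le_sqrt (hc hB))
    (Real.sqrt_nonneg _) (Real.sqrt_nonneg _) (Real.sqrt_pos.2 hAc) (Real.sqrt_le_sqrt (hc' hB))
    (Real.sqrt_le_sqrt (hc' (Finset.subset_univ _))) (hx A (by simp)) (hx _ (by simp))
    (hx B (by simp)) (hx Aᶜ (by simp))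

theorem stepContrast_mul_const {q : ℝ} (hq : 0 < q) (c : Finset ι → ℝ) (A B : Finset ι) :
    stepContrast (fun C => c C * q) A B = √q * stepContrast c A B := by
  simp only [stepContrast, Real.sqrt_mul' _ hq.le,
    mul_div_mul_right _ _ (Real.sqrt_pos.2 hq).ne']
  ring

theorem card_mul_card_compl_mul_card_sq_div_le_stepContrast_sq (A B : Finset ι) :
    (A.card : ℝ) * Aᶜ.card * B.card ^ 2 / Fintype.card ι ^ 3 ≤
      stepContrast (fun C => (C.card : ℝ)) A B ^ 2 := by
  have h_sq : stepContrast (fun C => (C.card : ℝ)) A B ^ 2 =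
      A.card / Fintype.card ι * (B.card / Aᶜ.card) * B.card := by
    simp only [stepContrast, mul_pow, div_pow, Real.sq_sqrt (Nat.cast_nonneg _),
      Finset.card_univ]
  have h_le : (Aᶜ.card : ℝ) ≤ Fintype.card ι := by exact_mod_cast Finset.card_le_univ Aᶜ
  rw [h_sq]
  rcases (Nat.cast_nonneg (α := ℝ) Aᶜ.card).eq_or_lt with h | h
  · simp [← h]
  have h_card : (0 : ℝ) < Fintype.card ι := h.trans_le h_le
  have h_inv : (Aᶜ.card : ℝ) / Fintype.card ι ^ 2 ≤ 1 / Aᶜ.card := by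
    rw [div_le_div_iff₀ (by positivity) h, one_mul, ← sq]
    gcongr
  calc (A.card : ℝ) * Aᶜ.card * B.card ^ 2 / Fintype.card ι ^ 3
      = (A.card : ℝ) * B.card ^ 2 / Fintype.card ι * (Aᶜ.card / Fintype.card ι ^ 2) := by
        field_simp
    _ ≤ (A.card : ℝ) * B.card ^ 2 / Fintype.card ι * (1 / Aᶜ.card) := by gcongr
    _ = (A.card : ℝ) / Fintype.card ι * (B.card / Aᶜ.card) * B.card := by ring

end Stability

section Segments

/-- The indices of the first `t` times; their complement holds the times after `t`. -/
def before (n t : ℕ) : Finset (Fin n) := Finset.univ.filter fun r => r.val < t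

theorem mem_before {n t : ℕ} {r : Fin n} : r ∈ before n t ↔ r.val < t := by simp [before]

theorem compl_before (n t : ℕ) :
    (before n t)ᶜ = Finset.univ.filter fun r : Fin n => t ≤ r.val := by
  ext r
  simp [before]

theorem before_mono (n : ℕ) : Monotone (before n) := fun _ _ hst _ hr =>
  mem_before.2 ((mem_before.1 hr).trans_le hst)

theorem before_self (n : ℕ) : before n n = Finset.univ :=
  Finset.filter_true_of_mem fun r _ => r.isLt

theorem card_before {n t : ℕ} (ht : t ≤ n) : (before n t).card = t := by
  simp [before, Fin.card_filter_val_lt, ht]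

theorem card_compl_before {n t : ℕ} (ht : t ≤ n) : (before n t)ᶜ.card = n - t := by
  rw [Finset.card_compl, Fintype.card_fin, card_before ht]

/-- The nonempty sets formed by the first times. -/
def initialSegments (n : ℕ) : Finset (Finset (Fin n)) := (Finset.Icc 1 n).image (before n)

/-- The nonempty sets formed by the first or by the last times. -/
def segments (n : ℕ) : Finset (Finset (Fin n)) :=
  initialSegments n ∪ (Finset.range n).image fun t => (before n t)ᶜ

variable {n t : ℕ}

theorem before_mem_initialSegments (ht : 1 ≤ t) (htn : t ≤ n) : before n t ∈ initialSegments n :=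
  Finset.mem_image_of_mem _ (Finset.mem_Icc.2 ⟨ht, htn⟩)

theorem before_mem_segments (ht : 1 ≤ t) (htn : t ≤ n) : before n t ∈ segments n :=
  Finset.mem_union_left _ (before_mem_initialSegments ht htn)

theorem compl_before_mem_segments (htn : t < n) : (before n t)ᶜ ∈ segments n :=
  Finset.mem_union_right _
    (Finset.mem_image_of_mem (fun t => (before n t)ᶜ) (Finset.mem_range.2 htn))

theorem nonempty_of_mem_segments {A : Finset (Fin n)} (hA : A ∈ segments n) : A.Nonempty := by
  rw [segments, initialSegments, Finset.mem_union, Finset.mem_image, Finset.mem_image] at hA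
  rcases hA with ⟨t, ht, rfl⟩ | ⟨t, ht, rfl⟩
  · rw [Finset.mem_Icc] at ht
    rw [← Finset.card_pos, card_before ht.2]
    exact ht.1
  · rw [Finset.mem_range] at ht
    rw [← Finset.card_pos, card_compl_before ht.le]
    exact Nat.sub_pos_of_lt ht

theorem card_initialSegments_le (n : ℕ) : (initialSegments n).card ≤ n :=
  Finset.card_image_le.trans_eq (Nat.card_Icc 1 n)

theorem card_segments_le (n : ℕ) : (segments n).card ≤ 2 * n := by
  rw [two_mul]
  refine (Finset.card_union_le _ _).trans (add_le_add (card_initialSegments_le n) ?_)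
  exact Finset.card_image_le.trans_eq (Finset.card_range n)

end Segments

section CUSUM

theorem missCUSUM_masked_apply {p n : ℕ} (M : Fin p → Fin n → ℝ) (O : Fin p → Fin n → Bool)
    (j : Fin p) (s : Fin (n - 1)) :
    missCUSUM (masked M O) O j s = contrastWeight (before n (s + 1)) (O j) ⬝ᵥ M j := by
  have ht : s.val + 1 ≤ n := by omega
  set A := before n (s + 1)
  have h_left : leftCount O j (s + 1) = successCount A (O j) := rfl
  have h_right : rightCount O j (n - (s + 1)) = successCount Aᶜ (O j) := by
    rw [rightCount, Nat.sub_sub_self ht, ← compl_before, successCount]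
  have h_total : leftCount O j n = successCount Finset.univ (O j) := by
    rw [← before_self n]
    rfl
  have h_mask (r : Fin n) : masked (masked M O) O j r = M j r * if O j r then 1 else 0 := by
    simp only [masked]
    split_ifs <;> ring
  simp only [missCUSUM, missCUSUMEntry, h_left, h_right, h_total, h_mask,
    contrastWeight_dotProduct, ← compl_before, one_div]
  split_ifs with h_pos
  · rfl
  · rcases not_and_or.1 h_pos with h | h
    · simp [le_antisymm (not_lt.1 h) (successCount_nonneg _ _)]
    · simp [le_antisymm (not_lt.1 h) (successCount_nonneg _ _)]

/-- The CUSUM at time `t` of a unit step after time `z`, where `c C` is the number of observations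
at the times in `C`. -/
noncomputable def cusumStep {n : ℕ} (c : Finset (Fin n) → ℝ) (z t : ℕ) : ℝ :=
  if t ≤ z then stepContrast c (before n t) (before n z)ᶜ
  else stepContrast c (before n t)ᶜ (before n z)

variable {p n z t : ℕ}

theorem contrastWeight_before_dotProduct_changeMean (ω : Fin n → Bool)
    (μ₁ μ₂ : EuclideanSpace ℝ (Fin p)) (j : Fin p) :
    contrastWeight (before n t) ω ⬝ᵥ changeMean n z μ₁ μ₂ j =
      (μ₂ j - μ₁ j) * cusumStep (successCount · ω) z t := by
  set a := contrastWeight (before n t) ω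
  have h_step (r : Fin n) : a r * changeMean n z μ₁ μ₂ j r =
      μ₁ j * a r + (μ₂ j - μ₁ j) * if r ∈ (before n z)ᶜ then a r else 0 := by
    simp only [changeMean, Finset.mem_compl, mem_before]
    split_ifs <;> ring
  have h_sum : ∑ r ∈ (before n z)ᶜ, a r = cusumStep (successCount · ω) z t := by
    rw [cusumStep]
    split_ifs with htz
    · exact sum_contrastWeight_of_subset_compl ω (Finset.compl_subset_compl.2 (before_mono n htz))
    · rw [← sum_contrastWeight_of_subset_compl ω
        ((compl_compl (before n t)).symm ▸ before_mono n (not_le.1 htz).le)]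
      simp only [contrastWeight_compl, Finset.sum_neg_distrib]
      rw [eq_neg_iff_add_eq_zero, add_comm, Finset.sum_add_sum_compl, sum_contrastWeight]
  rw [dotProduct, Finset.sum_congr rfl fun r _ => h_step r, Finset.sum_add_distrib,
    ← Finset.mul_sum, ← Finset.mul_sum, Finset.sum_ite_mem, Finset.univ_inter,
    sum_contrastWeight, h_sum, mul_zero, zero_add]

theorem cusumStep_mul_const {q : ℝ} (hq : 0 < q) (c : Finset (Fin n) → ℝ) (z t : ℕ) :
    cusumStep (fun C => c C * q) z t = √q * cusumStep c z t := by
  simp only [cusumStep, stepContrast_mul_const hq, mul_ite]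

theorem abs_cusumStep_sub_le {c c' : Finset (Fin n) → ℝ} {x : ℝ} (hc : Monotone c)
    (hc' : Monotone c') (hpos : ∀ C ∈ segments n, 0 < c' C)
    (hx : ∀ C ∈ segments n, |√(c C) - √(c' C)| ≤ x)
    (hz : 1 ≤ z) (hzn : z < n) (ht : 1 ≤ t) (htn : t < n) :
    |cusumStep c z t - cusumStep c' z t| ≤ 5 * x := by
  have h_before_t := before_mem_segments ht htn.le
  have h_after_t := compl_before_mem_segments htn
  have h_univ : (Finset.univ : Finset (Fin n)) ∈ segments n :=
    before_self n ▸ before_mem_segments (hz.trans hzn.le) le_rfl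
  rw [cusumStep, cusumStep]
  split_ifs with htz
  · refine abs_stepContrast_sub_le hc hc' (Finset.compl_subset_compl.2 (before_mono n htz))
      (hpos _ h_after_t) ?_
    rintro C (rfl | rfl | rfl | rfl)
    exacts [hx _ h_before_t, hx _ h_univ, hx _ (compl_before_mem_segments hzn), hx _ h_after_t]
  · refine abs_stepContrast_sub_le hc hc' ?_ ?_ ?_
    · rw [compl_compl]
      exact before_mono n (not_le.1 htz).le
    · rw [compl_compl]
      exact hpos _ h_before_t
    · rw [compl_compl]
      rintro C (rfl | rfl | rfl | rfl)
      exacts [hx _ h_after_t, hx _ h_univ, hx _ (before_mem_segments hz hzn.le), hx _ h_before_t]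

/-- The CUSUM, at the times `1, …, n - 1`, of a fully observed unit step after time `z`. -/
noncomputable def cusumProfile (n z : ℕ) : EuclideanSpace ℝ (Fin (n - 1)) :=
  WithLp.toLp 2 fun s => cusumStep (n := n) (fun C => (C.card : ℝ)) z (s + 1)

theorem le_cusumStep_card_sq (hzn : z ≤ n) (htn : t ≤ n) :
    (t : ℝ) * (n - t) * min (z : ℝ) (n - z) ^ 2 / n ^ 3 ≤
      cusumStep (n := n) (fun C => (C.card : ℝ)) z t ^ 2 := by
  have hzn' : (0 : ℝ) ≤ n - z := sub_nonneg.2 (Nat.cast_le.2 hzn)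
  have htn' : (0 : ℝ) ≤ n - t := sub_nonneg.2 (Nat.cast_le.2 htn)
  have : 0 ≤ min (z : ℝ) (n - z) := le_min (Nat.cast_nonneg z) hzn'
  rw [cusumStep]
  split_ifs with htz
  · refine le_trans ?_ (card_mul_card_compl_mul_card_sq_div_le_stepContrast_sq _ _)
    rw [card_before htn, card_compl_before htn, card_compl_before hzn, Fintype.card_fin,
      Nat.cast_sub htn, Nat.cast_sub hzn]
    gcongr
    exact min_le_right _ _
  · refine le_trans ?_ (card_mul_card_compl_mul_card_sq_div_le_stepContrast_sq _ _)
    rw [compl_compl, card_before htn, card_compl_before htn, card_before hzn, Fintype.card_fin,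
      Nat.cast_sub htn, mul_comm (n - t : ℝ)]
    gcongr
    exact min_le_left _ _

theorem sum_range_succ_mul_sub (N : ℕ) (a : ℝ) :
    ∑ i ∈ Finset.range N, ((i : ℝ) + 1) * (a - (i + 1)) =
      N * (N + 1) * (3 * a - 2 * N - 1) / 6 := by
  induction N with
  | zero => simp
  | succ N ih =>
    rw [Finset.sum_range_succ, ih]
    push_cast
    ring

theorem mul_changeTau_div_four_le_norm_cusumProfile (hn : 2 ≤ n) (hzn : z ≤ n) :
    n * changeTau n z / 4 ≤ ‖cusumProfile n z‖ := by
  have hn' : (2 : ℝ) ≤ n := by exact_mod_cast hn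
  have hn_pos : (0 : ℝ) < n := by linarith
  set a := min (z : ℝ) (n - z)
  have h_sum : a ^ 2 * ((n : ℝ) ^ 2 - 1) / (6 * n ^ 2) ≤ ‖cusumProfile n z‖ ^ 2 :=
    calc a ^ 2 * ((n : ℝ) ^ 2 - 1) / (6 * n ^ 2)
        = (∑ i ∈ Finset.range (n - 1), ((i : ℝ) + 1) * (n - (i + 1))) * (a ^ 2 / n ^ 3) := by
          rw [sum_range_succ_mul_sub, Nat.cast_sub (by omega), Nat.cast_one]
          field_simp
          ring
      _ = ∑ s : Fin (n - 1), ((s + 1 : ℕ) : ℝ) * (n - (s + 1 : ℕ)) * a ^ 2 / n ^ 3 := by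
          rw [← Fin.sum_univ_eq_sum_range fun i => ((i : ℝ) + 1) * (n - (i + 1)), Finset.sum_mul]
          refine Finset.sum_congr rfl fun s _ => ?_
          push_cast
          ring
      _ ≤ ‖cusumProfile n z‖ ^ 2 := by
          rw [EuclideanSpace.real_norm_sq_eq]
          exact Finset.sum_le_sum fun s _ => le_cusumStep_card_sq hzn (by omega)
  have h_scale : (a / 4) ^ 2 ≤ a ^ 2 * ((n : ℝ) ^ 2 - 1) / (6 * n ^ 2) := by
    rw [le_div_iff₀ (by positivity)]
    nlinarith [sq_nonneg a, mul_nonneg (sq_nonneg a) (by nlinarith : (0 : ℝ) ≤ n ^ 2 - 4)]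
  rw [changeTau, mul_div_cancel₀ _ hn_pos.ne']
  exact le_of_sq_le_sq (h_scale.trans h_sum) (norm_nonneg _)

end CUSUM

section Events

theorem measureReal_prod_le_of_forall_section {α β : Type*} [MeasurableSpace α]
    [MeasurableSpace β] {μ : Measure α} [IsFiniteMeasure μ] {ν : Measure β}
    [IsProbabilityMeasure ν] {s : Set (α × β)} (hs : MeasurableSet s) {c : ℝ}
    (h : ∀ y, μ.real ((fun x => (x, y)) ⁻¹' s) ≤ c) : (μ.prod ν).real s ≤ c := by
  obtain ⟨y₀⟩ := ν.nonempty_of_neZero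
  refine ENNReal.toReal_le_of_le_ofReal (measureReal_nonneg.trans (h y₀)) ?_
  calc μ.prod ν s = ∫⁻ y, μ ((fun x => (x, y)) ⁻¹' s) ∂ν := Measure.prod_apply_symm hs
    _ ≤ ∫⁻ _, ENNReal.ofReal c ∂ν := lintegral_mono fun y => by
      rw [← ofReal_measureReal]
      exact ENNReal.ofReal_le_ofReal (h y)
    _ = ENNReal.ofReal c := by simp

theorem measureReal_biUnion_finset_le_card_mul {α ι : Type*} [MeasurableSpace α] {μ : Measure α}
    (I : Finset ι) {s : ι → Set α} {c : ℝ} (h : ∀ i ∈ I, μ.real (s i) ≤ c) :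
    μ.real (⋃ i ∈ I, s i) ≤ I.card * c :=
  (measureReal_biUnion_finset_le I s).trans <|
    (Finset.sum_le_card_nsmul I _ c h).trans_eq (nsmul_eq_mul _ _)

theorem exists_measurableSet_of_hasLaw {S 𝓧 : Type*} [MeasurableSpace S] [MeasurableSpace 𝓧]
    {P : Measure S} {ν : Measure 𝓧} [IsProbabilityMeasure ν] {Y : S → 𝓧} (hY : HasLaw Y ν P)
    {B : Set 𝓧} (hB : MeasurableSet B) :
    ∃ E, MeasurableSet E ∧ 1 - ν.real B ≤ P.real E ∧ ∀ s ∈ E, Y s ∉ B := by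
  obtain ⟨E, h_subset, h_meas, h_ae⟩ :=
    (hY.aemeasurable.nullMeasurable hB.compl).exists_measurable_subset_ae_eq
  refine ⟨E, h_meas, ?_, h_subset⟩
  rw [measureReal_congr h_ae, ← probReal_compl_eq_one_sub hB, measureReal_def, measureReal_def,
    ← Measure.map_apply_of_aemeasurable hY.aemeasurable hB.compl, hY.map_eq]

variable {p n : ℕ}

/-- The event that, for noise `y.1 - m` revealed by `y.2`, the contrast of some row over some
initial segment exceeds `u` in absolute value. -/
def largeNoise (m : Fin p → Fin n → ℝ) (u : ℝ) :
    Set ((Fin p → Fin n → ℝ) × (Fin p → Fin n → Bool)) :=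
  ⋃ i ∈ (Finset.univ : Finset (Fin p)) ×ˢ initialSegments n,
    {y | u < |contrastWeight i.2 (y.2 i.1) ⬝ᵥ (y.1 i.1 - m i.1)|}

/-- The event that, in some row of `J`, the number of observations in some segment deviates from
its mean by more than `x` on the square-root scale. -/
def irregularCounts (q : Fin p → unitInterval) (J : Finset (Fin p)) (x : ℝ) :
    Set ((Fin p → Fin n → ℝ) × (Fin p → Fin n → Bool)) :=
  ⋃ i ∈ J ×ˢ segments n,
    {y | x < |√(successCount i.2 (y.2 i.1)) - √(i.2.card * q i.1)|}

theorem measurableSet_lt_abs_contrast (A : Finset (Fin n)) (j : Fin p) (m : Fin n → ℝ) (u : ℝ) :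
    MeasurableSet {y : (Fin p → Fin n → ℝ) × (Fin p → Fin n → Bool) |
      u < |contrastWeight A (y.2 j) ⬝ᵥ (y.1 j - m)|} := by
  have h_weight (r : Fin n) : Measurable fun y : (Fin p → Fin n → ℝ) × (Fin p → Fin n → Bool) =>
      contrastWeight A (y.2 j) r :=
    (measurable_of_countable fun O : Fin p → Fin n → Bool => contrastWeight A (O j) r).comp
      measurable_snd
  refine measurableSet_lt measurable_const (Measurable.abs ?_)
  exact Finset.measurable_fun_sum _ fun r _ => (h_weight r).mul (by fun_prop)

theorem measurableSet_largeNoise (m : Fin p → Fin n → ℝ) (u : ℝ) :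
    MeasurableSet (largeNoise m u) :=
  Finset.measurableSet_biUnion _ fun i _ => measurableSet_lt_abs_contrast i.2 i.1 (m i.1) u

theorem measurableSet_irregularCounts (q : Fin p → unitInterval) (J : Finset (Fin p)) (x : ℝ) :
    MeasurableSet (irregularCounts (n := n) q J x) :=
  Finset.measurableSet_biUnion _ fun i _ =>
    measurable_snd (Set.to_countable
      {O : Fin p → Fin n → Bool | x < |√(successCount i.2 (O i.1)) - √(i.2.card * q i.1)|}
      ).measurableSet

variable (z : ℕ) (μ₁ μ₂ : EuclideanSpace ℝ (Fin p)) (σ : ℝ) (q : Fin p → unitInterval)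

instance : IsProbabilityMeasure (modelLaw n z μ₁ μ₂ σ q) := by
  unfold modelLaw
  infer_instance

theorem measureReal_lt_abs_contrast_le (A : Finset (Fin n)) (j : Fin p) {u : ℝ} (hu : 0 ≤ u) :
    (modelLaw n z μ₁ μ₂ σ q).real
        {y | u < |contrastWeight A (y.2 j) ⬝ᵥ (y.1 j - changeMean n z μ₁ μ₂ j)|} ≤
      2 * Real.exp (-u ^ 2 / (2 * σ ^ 2)) := by
  refine measureReal_prod_le_of_forall_section (measurableSet_lt_abs_contrast A j _ u) fun O => ?_
  have h_row := (measurePreserving_eval (fun j => Measure.pi fun r =>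
      gaussianReal (changeMean n z μ₁ μ₂ j r) (σ ^ 2).toNNReal) j).measureReal_preimage
    (s := {x | u < |contrastWeight A (O j) ⬝ᵥ (x - changeMean n z μ₁ μ₂ j)|})
    (measurableSet_lt measurable_const
      (by simp only [dotProduct, Pi.sub_apply]; fun_prop)).nullMeasurableSet
  have h_tail := measureReal_lt_abs_le_of_hasSubgaussianMGF
    (hasSubgaussianMGF_dotProduct_sub_gaussian (changeMean n z μ₁ μ₂ j) _ (σ ^ 2).toNNReal
      (sum_contrastWeight_sq_le_one A (O j))) hu
  rw [Real.coe_toNNReal _ (sq_nonneg σ)] at h_tail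
  exact h_row.trans_le h_tail

theorem measureReal_largeNoise_le {u : ℝ} (hu : 0 ≤ u) :
    (modelLaw n z μ₁ μ₂ σ q).real (largeNoise (changeMean n z μ₁ μ₂) u) ≤
      p * n * (2 * Real.exp (-u ^ 2 / (2 * σ ^ 2))) := by
  refine (measureReal_biUnion_finset_le_card_mul _ fun i _ =>
    measureReal_lt_abs_contrast_le z μ₁ μ₂ σ q i.2 i.1 hu).trans ?_
  rw [Finset.card_product, Finset.card_univ, Fintype.card_fin, Nat.cast_mul]
  gcongr
  exact card_initialSegments_le n

theorem measureReal_row_mem (j : Fin p) (s : Set (Fin n → Bool)) :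
    (modelLaw n z μ₁ μ₂ σ q).real {y | y.2 j ∈ s} =
      (Measure.pi fun _ : Fin n => bernoulliMeasure true false (q j)).real s :=
  ((measurePreserving_eval (fun j => Measure.pi fun _ : Fin n =>
    bernoulliMeasure true false (q j)) j).comp measurePreserving_snd).measureReal_preimage
      s.to_countable.measurableSet.nullMeasurableSet

variable {q}

theorem measureReal_irregularCounts_le (hq : ∀ j, 0 < q j) (J : Finset (Fin p)) {x : ℝ}
    (hx : 0 ≤ x) :
    (modelLaw n z μ₁ μ₂ σ q).real (irregularCounts q J x) ≤
      J.card * (2 * n) * (2 * Real.exp (-x ^ 2)) := by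
  refine (measureReal_biUnion_finset_le_card_mul _ fun i hi => ?_).trans
    (b := (J ×ˢ segments n).card * (2 * Real.exp (-x ^ 2))) ?_
  · have h_mean : 0 < i.2.card * (q i.1 : ℝ) :=
      mul_pos (Nat.cast_pos.2 (nonempty_of_mem_segments (Finset.mem_product.1 hi).2).card_pos)
        (hq i.1)
    exact (measureReal_row_mem z μ₁ μ₂ σ q i.1 _).trans_le
      ((hasSubPoissonMGF_successCount (q i.1) i.2).measureReal_lt_abs_sqrt_sub_sqrt_le h_mean hx)
  · rw [Finset.card_product, Nat.cast_mul]
    gcongr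
    exact_mod_cast card_segments_le n

variable {σ}

theorem measureReal_largeNoise_union_irregularCounts_le (hσ : 0 < σ) (hq : ∀ j, 0 < q j)
    (hp : 1 ≤ p) (hn : 1 ≤ n) {k : ℕ} (hk : 1 ≤ k) {J : Finset (Fin p)} (hJ : J.card ≤ k) :
    (modelLaw n z μ₁ μ₂ σ q).real
        (largeNoise (changeMean n z μ₁ μ₂) (σ * √(2 * Real.log (p * n * (k * n)))) ∪
          irregularCounts q J √(2 * Real.log (k * n))) ≤ 6 / (k * n) := by
  have hp' : (1 : ℝ) ≤ p := Nat.one_le_cast.2 hp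
  have hn' : (1 : ℝ) ≤ n := Nat.one_le_cast.2 hn
  have hk' : (1 : ℝ) ≤ k := Nat.one_le_cast.2 hk
  have h_kn : 1 ≤ (k : ℝ) * n := one_le_mul_of_one_le_of_one_le hk' hn'
  have h_pnkn : 1 ≤ (p : ℝ) * n * (k * n) :=
    one_le_mul_of_one_le_of_one_le (one_le_mul_of_one_le_of_one_le hp' hn') h_kn
  have h_noise := measureReal_largeNoise_le (n := n) z μ₁ μ₂ σ q
    (u := σ * √(2 * Real.log (p * n * (k * n)))) (by positivity)
  have h_counts := measureReal_irregularCounts_le (n := n) z μ₁ μ₂ σ hq J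
    (Real.sqrt_nonneg (2 * Real.log (k * n)))
  have h_noise_exp : Real.exp (-(σ * √(2 * Real.log (p * n * (k * n)))) ^ 2 / (2 * σ ^ 2)) =
      (p * n * (k * n) : ℝ)⁻¹ := by
    rw [mul_pow, Real.sq_sqrt (mul_nonneg two_pos.le (Real.log_nonneg h_pnkn)),
      ← Real.exp_log (inv_pos.2 (one_pos.trans_le h_pnkn)), Real.log_inv]
    congr 1
    field_simp
  have h_counts_exp : Real.exp (-√(2 * Real.log (k * n)) ^ 2) = ((k * n : ℝ)⁻¹) ^ 2 := by
    rw [Real.sq_sqrt (mul_nonneg two_pos.le (Real.log_nonneg h_kn)), two_mul, neg_add,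
      Real.exp_add, Real.exp_neg, Real.exp_log (one_pos.trans_le h_kn), sq]
  rw [h_noise_exp] at h_noise
  rw [h_counts_exp] at h_counts
  calc _ ≤ _ := measureReal_union_le _ _
    _ ≤ p * n * (2 * (p * n * (k * n) : ℝ)⁻¹) + J.card * (2 * n) * (2 * ((k * n : ℝ)⁻¹) ^ 2) :=
      add_le_add h_noise h_counts
    _ ≤ p * n * (2 * (p * n * (k * n) : ℝ)⁻¹) + k * (2 * n) * (2 * ((k * n : ℝ)⁻¹) ^ 2) := by
      gcongr
    _ = 6 / (k * n) := by
      field_simp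
      norm_num

end Events

section Assembly

variable {p n z : ℕ}

theorem norm_oracleDirection (q : Fin p → unitInterval) (θ : EuclideanSpace ℝ (Fin p)) :
    ‖oracleDirection q θ‖ = weightedNorm q θ := by
  rw [EuclideanSpace.norm_eq, weightedNorm]
  congr 1
  refine Finset.sum_congr rfl fun j _ => ?_
  rw [oracleDirection, Real.norm_eq_abs, sq_abs, mul_pow, Real.sq_sqrt (q j).2.1]

theorem oracleDirection_apply_eq_zero_iff {q : Fin p → unitInterval} (hq : ∀ j, 0 < q j)
    (θ : EuclideanSpace ℝ (Fin p)) (j : Fin p) : oracleDirection q θ j = 0 ↔ θ j = 0 := by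
  have h_sqrt : √(q j : ℝ) ≠ 0 := (Real.sqrt_pos.2 (hq j)).ne'
  simp [oracleDirection, h_sqrt]

theorem oracleDirection_ne_zero {q : Fin p → unitInterval} (hq : ∀ j, 0 < q j)
    {θ : EuclideanSpace ℝ (Fin p)} (hθ : θ ≠ 0) : oracleDirection q θ ≠ 0 := fun h =>
  hθ (by ext j; exact (oracleDirection_apply_eq_zero_iff hq θ j).1 (by rw [h]; rfl))

theorem changeTau_pos (hz : 1 ≤ z) (hzn : z < n) : 0 < changeTau n z := by
  have hz' : (0 : ℝ) < z := Nat.cast_pos.2 hz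
  have hzn' : (z : ℝ) < n := Nat.cast_lt.2 hzn
  exact div_pos (lt_min hz' (sub_pos.2 hzn')) (hz'.trans hzn')

theorem norm_toLp_le_sqrt_card_mul {ι : Type*} [Fintype ι] {f : ι → ℝ} {C : ℝ} (hC : 0 ≤ C)
    (h : ∀ i, |f i| ≤ C) : ‖WithLp.toLp 2 f‖ ≤ √(Fintype.card ι) * C := by
  rw [EuclideanSpace.norm_eq]
  refine Real.sqrt_le_iff.2 ⟨by positivity, ?_⟩
  rw [mul_pow, Real.sq_sqrt (Nat.cast_nonneg _), ← nsmul_eq_mul]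
  exact Finset.sum_le_card_nsmul _ _ _ fun i _ => pow_le_pow_left₀ (norm_nonneg _) (h i) 2

theorem norm_toLp_pred_le_sqrt_mul {f : Fin (n - 1) → ℝ} {C : ℝ} (hC : 0 ≤ C)
    (h : ∀ i, |f i| ≤ C) : ‖WithLp.toLp 2 f‖ ≤ √n * C := by
  refine (norm_toLp_le_sqrt_card_mul hC h).trans ?_
  rw [Fintype.card_fin]
  gcongr
  exact Nat.sub_le n 1

/-- Row `j` of the MissCUSUM transformation of the noise `M - m`. -/
noncomputable def noiseRow (m M : Fin p → Fin n → ℝ) (O : Fin p → Fin n → Bool) (j : Fin p) :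
    EuclideanSpace ℝ (Fin (n - 1)) :=
  WithLp.toLp 2 fun s => contrastWeight (before n (s + 1)) (O j) ⬝ᵥ (M j - m j)

/-- The error made in row `j` of the MissCUSUM transformation of the mean matrix, with change `θ`
after time `z`, when the numbers of observations are replaced by their expectations. -/
noncomputable def biasRow (z : ℕ) (θ : EuclideanSpace ℝ (Fin p)) (q : Fin p → unitInterval)
    (O : Fin p → Fin n → Bool) (j : Fin p) : EuclideanSpace ℝ (Fin (n - 1)) :=
  WithLp.toLp 2 fun s => θ j * (cusumStep (successCount · (O j)) z (s + 1) -
    cusumStep (n := n) (fun C => C.card * (q j : ℝ)) z (s + 1))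

theorem toLp_missCUSUM_masked_eq {q : Fin p → unitInterval} (hq : ∀ j, 0 < q j)
    (μ₁ μ₂ : EuclideanSpace ℝ (Fin p)) (M : Fin p → Fin n → ℝ) (O : Fin p → Fin n → Bool)
    (j : Fin p) :
    WithLp.toLp 2 (missCUSUM (masked M O) O j) =
      oracleDirection q (μ₂ - μ₁) j • cusumProfile n z +
        noiseRow (changeMean n z μ₁ μ₂) M O j + biasRow z (μ₂ - μ₁) q O j := by
  ext s
  have h_q : (0 : ℝ) < q j := hq j
  have h_mean := contrastWeight_before_dotProduct_changeMean (z := z) (t := s + 1) (O j) μ₁ μ₂ j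
  simp only [oracleDirection, cusumProfile, noiseRow, biasRow, PiLp.add_apply, PiLp.smul_apply,
    PiLp.sub_apply, smul_eq_mul, missCUSUM_masked_apply, dotProduct_sub, h_mean,
    cusumStep_mul_const h_q]
  ring

theorem norm_noiseRow_le {m M : Fin p → Fin n → ℝ} {O : Fin p → Fin n → Bool} {u : ℝ}
    (hu : 0 ≤ u) (h : (M, O) ∉ largeNoise m u) (j : Fin p) : ‖noiseRow m M O j‖ ≤ √n * u := by
  refine norm_toLp_pred_le_sqrt_mul hu fun s => not_lt.1 fun h_lt => h ?_
  refine Set.mem_biUnion (x := (j, before n (s + 1))) ?_ h_lt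
  exact Finset.mem_product.2
    ⟨Finset.mem_univ j, before_mem_initialSegments (Nat.le_add_left 1 s) (by omega)⟩

theorem norm_biasRow_le (hz : 1 ≤ z) (hzn : z < n) {q : Fin p → unitInterval}
    (hq : ∀ j, 0 < q j) {θ : EuclideanSpace ℝ (Fin p)} {J : Finset (Fin p)}
    (hJ : ∀ j, θ j ≠ 0 → j ∈ J) {x : ℝ} (hx : 0 ≤ x) {M : Fin p → Fin n → ℝ}
    {O : Fin p → Fin n → Bool} (h : (M, O) ∉ irregularCounts q J x) (j : Fin p) :
    ‖biasRow z θ q O j‖ ≤ √n * (|θ j| * (5 * x)) := by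
  refine norm_toLp_pred_le_sqrt_mul (by positivity) fun s => ?_
  rw [abs_mul]
  by_cases hj : θ j = 0
  · simp [hj]
  have h_counts (C) (hC : C ∈ segments n) :
      |√(successCount C (O j)) - √(C.card * (q j : ℝ))| ≤ x :=
    not_lt.1 fun h_lt => h
      (Set.mem_biUnion (x := (j, C)) (Finset.mem_product.2 ⟨hJ j hj, hC⟩) h_lt)
  have h_mean_mono : Monotone fun C : Finset (Fin n) => C.card * (q j : ℝ) := fun _ _ h_le =>
    mul_le_mul_of_nonneg_right (Nat.cast_le.2 (Finset.card_le_card h_le)) (q j).2.1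
  gcongr
  exact abs_cusumStep_sub_le (successCount_mono (O j)) h_mean_mono
    (fun C hC => mul_pos (Nat.cast_pos.2 (nonempty_of_mem_segments hC).card_pos) (hq j))
    h_counts hz hzn (Nat.le_add_left 1 s) (by omega)

theorem sum_norm_biasRow_sq_le (hz : 1 ≤ z) (hzn : z < n) {q : Fin p → unitInterval}
    (hq : ∀ j, 0 < q j) {θ : EuclideanSpace ℝ (Fin p)} {J : Finset (Fin p)}
    (hJ : ∀ j, θ j ≠ 0 → j ∈ J) {x : ℝ} (hx : 0 ≤ x) {M : Fin p → Fin n → ℝ}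
    {O : Fin p → Fin n → Bool} (h : (M, O) ∉ irregularCounts q J x) :
    ∑ j, ‖biasRow z θ q O j‖ ^ 2 ≤ (√n * (‖θ‖ * (5 * x))) ^ 2 :=
  calc ∑ j, ‖biasRow z θ q O j‖ ^ 2 ≤ ∑ j, (√n * (|θ j| * (5 * x))) ^ 2 :=
        Finset.sum_le_sum fun j _ =>
          pow_le_pow_left₀ (norm_nonneg _) (norm_biasRow_le hz hzn hq hJ hx h j) 2
    _ = (√n * (‖θ‖ * (5 * x))) ^ 2 := by
        simp only [mul_pow, sq_abs, ← Finset.mul_sum, ← Finset.sum_mul,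
          EuclideanSpace.real_norm_sq_eq]

theorem sin_acuteAngle_oracleDirection_le {k : ℕ} (hz : 1 ≤ z) (hzn : z < n)
    {μ₁ μ₂ : EuclideanSpace ℝ (Fin p)} (hθ : μ₂ - μ₁ ≠ 0)
    (hk : (Finset.univ.filter fun j => (μ₂ - μ₁) j ≠ 0).card ≤ k)
    {q : Fin p → unitInterval} (hq : ∀ j, 0 < q j) {lam u δ x : ℝ} (hlam : 0 ≤ lam)
    (hu : 0 ≤ u) (hδ : 0 ≤ δ) (hx : 0 ≤ x) (hul : √n * u ≤ lam + δ)
    {M : Fin p → Fin n → ℝ} {O : Fin p → Fin n → Bool}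
    (h_noise : (M, O) ∉ largeNoise (changeMean n z μ₁ μ₂) u)
    (h_counts : (M, O) ∉
      irregularCounts q (Finset.univ.filter fun j => (μ₂ - μ₁) j ≠ 0) x)
    {v : EuclideanSpace ℝ (Fin p)} {w : EuclideanSpace ℝ (Fin (n - 1))}
    (hvw : IsArgmax (missCUSUM (masked M O) O) lam v w) :
    Real.sin (acuteAngle v (oracleDirection q (μ₂ - μ₁))) ≤
      2 * (2 * lam * √k + δ * √p + √n * (‖μ₂ - μ₁‖ * (5 * x))) /
        (weightedNorm q (μ₂ - μ₁) * (n * changeTau n z / 4)) := by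
  have hn : (0 : ℝ) < n := Nat.cast_pos.2 (by omega)
  have hτ := changeTau_pos hz hzn
  have h_profile := mul_changeTau_div_four_le_norm_cusumProfile (n := n) (by omega) hzn.le
  have h_profile_ne : cusumProfile n z ≠ 0 :=
    norm_pos_iff.1 (lt_of_lt_of_le (by positivity) h_profile)
  have h_oracle_ne := oracleDirection_ne_zero hq hθ
  have h_angle := hvw.sin_acuteAngle_le (k := k) hlam hδ (by positivity) h_oracle_ne h_profile_ne
    (by simpa only [ne_eq, oracleDirection_apply_eq_zero_iff hq] using hk)
    (toLp_missCUSUM_masked_eq hq μ₁ μ₂ M O)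
    (fun j => (norm_noiseRow_le hu h_noise j).trans hul)
    (sum_norm_biasRow_sq_le hz hzn hq (fun j hj => Finset.mem_filter.2 ⟨Finset.mem_univ j, hj⟩)
      hx h_counts)
  have h_norm_pos := norm_pos_iff.2 h_oracle_ne
  rw [norm_oracleDirection] at h_angle h_norm_pos
  refine h_angle.trans ?_
  gcongr

theorem sqrt_two_mul_log_mul_le {a b : ℝ} (ha : 2 ≤ a) (hb : 0 < b) :
    √(2 * Real.log (a * b)) ≤ 2 * √(Real.log a) * (1 + √(b / a)) := by
  have ha' : 0 < a := by linarith
  have h_log : 1 / 2 ≤ Real.log a := by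
    linarith [Real.log_two_gt_d9, Real.log_le_log two_pos ha]
  have h_split : Real.log (a * b) = 2 * Real.log a + Real.log (b / a) := by
    rw [Real.log_mul ha'.ne' hb.ne', Real.log_div hb.ne' ha'.ne']
    ring
  have h_ratio := Real.log_le_sub_one_of_pos (div_pos hb ha')
  have h_ratio_sq := Real.sq_sqrt (div_pos hb ha').le
  refine Real.sqrt_le_iff.2 ⟨by positivity, ?_⟩
  rw [mul_pow, mul_pow, Real.sq_sqrt (by linarith), h_split]
  nlinarith [mul_nonneg (by linarith : 0 ≤ Real.log a) (Real.sqrt_nonneg (b / a)),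
    mul_le_mul_of_nonneg_right h_log (div_pos hb ha').le]

theorem sqrt_mul_noise_threshold_le {k : ℕ} (hp : 1 ≤ p) (hn : 2 ≤ n) (hk : 1 ≤ k) {σ lam : ℝ}
    (hσ : 0 ≤ σ) (hlam : 2 * σ * √(n * Real.log (p * n)) ≤ lam) :
    √n * (σ * √(2 * Real.log (p * n * (k * n)))) ≤ lam + lam * √(k / p) := by
  have hp' : (1 : ℝ) ≤ p := Nat.one_le_cast.2 hp
  have hn' : (2 : ℝ) ≤ n := by exact_mod_cast hn
  have : (0 : ℝ) < k := Nat.cast_pos.2 hk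
  have h_log := sqrt_two_mul_log_mul_le (a := p * n) (b := k * n) (by nlinarith) (by positivity)
  rw [mul_div_mul_right _ _ (by positivity)] at h_log
  calc √n * (σ * √(2 * Real.log (p * n * (k * n))))
      ≤ √n * (σ * (2 * √(Real.log (p * n)) * (1 + √(k / p)))) := by gcongr
    _ = 2 * σ * √(n * Real.log (p * n)) * (1 + √(k / p)) := by
      rw [Real.sqrt_mul (Nat.cast_nonneg n)]
      ring
    _ ≤ lam * (1 + √(k / p)) := by gcongr
    _ = lam + lam * √(k / p) := by ring

theorem angle_bound_le {n k τ W lam t : ℝ} (hn : 0 < n) (hτ : 0 < τ) (hW : 0 < W)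
    (hlam : 0 ≤ lam) (ht : 0 ≤ t) (L : ℝ) :
    2 * (2 * lam * √k + lam * √k + √n * (t * (5 * √(2 * L)))) / (W * (n * τ / 4)) ≤
      32 * lam * √k / (n * τ * W) + 112 * t / (τ * W) * √(6 * L / n) := by
  have h_scale : √n * √(2 * L) = n * √(2 * L / n) := by
    rw [Real.sqrt_div' _ hn.le]
    field_simp
    rw [Real.sq_sqrt hn.le, mul_comm]
  have h_mono : √(2 * L / n) ≤ √(6 * L / n) := by
    rcases le_or_gt 0 L with hL | hL
    · gcongr
      norm_num
    · rw [Real.sqrt_eq_zero_of_nonpos (div_nonpos_of_nonpos_of_nonneg (by linarith) hn.le)]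
      exact Real.sqrt_nonneg _
  calc _ = 24 * lam * √k / (n * τ * W) + 40 * t / (τ * W) * √(2 * L / n) := by
        rw [show √n * (t * (5 * √(2 * L))) = 5 * t * (√n * √(2 * L)) by ring, h_scale]
        field_simp
        ring
    _ ≤ _ := by
        gcongr <;> norm_num

end Assembly

end MissInspect

open MissInspect in
/-- The event `E` makes the probability bound meaningful for an arbitrary, possibly
non-measurable, choice of maximisers. -/
theorem proposition1 {S : Type*} [MeasurableSpace S] (P : Measure S) [IsProbabilityMeasure P]
    (p n z k : ℕ) (hz : 1 ≤ z) (hzn : z < n)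
    (μ₁ μ₂ θ : EuclideanSpace ℝ (Fin p)) (hθ : θ = μ₂ - μ₁) (hθ0 : θ ≠ 0)
    (hk : (Finset.univ.filter fun j => θ j ≠ 0).card ≤ k)
    (σ : ℝ) (hσ : 0 < σ) (q : Fin p → unitInterval) (hq : ∀ j, 0 < q j)
    (X : S → Fin p → Fin n → ℝ) (O : S → Fin p → Fin n → Bool)
    (hXO : HasLaw (fun s => (X s, O s)) (MissInspect.modelLaw n z μ₁ μ₂ σ q) P)
    (lam : ℝ) (hlam : 2 * σ * √(n * Real.log (p * n)) ≤ lam)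
    (v : S → EuclideanSpace ℝ (Fin p)) (w : S → EuclideanSpace ℝ (Fin (n - 1)))
    (hvw : ∀ s, MissInspect.IsArgmax
      (MissInspect.missCUSUM (MissInspect.masked (X s) (O s)) (O s)) lam (v s) (w s)) :
    ∃ E : Set S, MeasurableSet E ∧ 1 - 6 / ((k : ℝ) * n) ≤ P.real E ∧
      ∀ s ∈ E,
        Real.sin (MissInspect.acuteAngle (v s) (MissInspect.oracleDirection q θ)) ≤
          32 * lam * √k / (n * MissInspect.changeTau n z * MissInspect.weightedNorm q θ) +
          112 * ‖θ‖ / (MissInspect.changeTau n z * MissInspect.weightedNorm q θ) *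
            √(6 * Real.log (k * n) / n) := by
  subst hθ
  obtain ⟨j₀, hj₀⟩ : ∃ j, (μ₂ - μ₁) j ≠ 0 := by
    by_contra! h
    exact hθ0 (PiLp.ext h)
  have hp : 1 ≤ p := j₀.pos
  have hk1 : 1 ≤ k :=
    (Finset.card_pos.2 ⟨j₀, Finset.mem_filter.2 ⟨Finset.mem_univ j₀, hj₀⟩⟩).trans_le hk
  have hlam0 : 0 ≤ lam := le_trans (by positivity) hlam
  have h_prob := measureReal_largeNoise_union_irregularCounts_le (n := n) z μ₁ μ₂ hσ hq hp
    (by omega) hk1 hk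
  obtain ⟨E, hE, hE_prob, hE_good⟩ := exists_measurableSet_of_hasLaw hXO
    ((measurableSet_largeNoise (changeMean n z μ₁ μ₂)
      (σ * √(2 * Real.log (p * n * (k * n))))).union
      (measurableSet_irregularCounts q _ √(2 * Real.log (k * n))))
  refine ⟨E, hE, (sub_le_sub_left h_prob 1).trans hE_prob, fun s hs => ?_⟩
  obtain ⟨h_noise, h_counts⟩ := not_or.1 (hE_good s hs)
  have h_angle := sin_acuteAngle_oracleDirection_le hz hzn hθ0 hk hq hlam0 (by positivity)
    (by positivity) (Real.sqrt_nonneg _)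
    (sqrt_mul_noise_threshold_le hp (by omega) hk1 hσ.le hlam) h_noise h_counts (hvw s)
  rw [mul_assoc lam, ← Real.sqrt_mul (by positivity),
    div_mul_cancel₀ _ (Nat.cast_ne_zero.2 (Nat.pos_iff_ne_zero.1 hp))] at h_angle
  refine h_angle.trans (angle_bound_le (Nat.cast_pos.2 (by omega)) (changeTau_pos hz hzn) ?_ hlam0
    (norm_nonneg _) _)
  rw [← norm_oracleDirection]
  exact norm_pos_iff.2 (oracleDirection_ne_zero hq hθ0)
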